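/- Let $d\ge 1$, $0<s<d/2$, and let $u:\mathbb R^d\to\mathbb R$ lie in the weighted space $\mathscr L^1_{2s}(\mathbb R^d)$, i.e. $u\in L^1_{loc}(\mathbb R^d)$ and $$\int_{\mathbb R^d}\frac{|u(x)|}{(1+|x|)^{d+2s}}\,dx<\infty .$$ Suppose that $(-\Delta)^s u=0$ in the sense of distributions on all of $\mathbb R^d$, i.e. $$\int_{\mathbb R^d}u(x)\,(-\Delta)^s\varphi(x)\,dx=0\qquad\text{for every }\varphi\in C_c^\infty(\mathbb R^d),$$ where $(-\Delta)^s\varphi:=\mathscr F^{-1}\big[|\xi|^{2s}\mathscr F[\varphi]\big]$ and $\mathscr F[\varphi](\xi)=\int_{\mathbb R^d}\varphi(x)e^{-ix\cdot\xi}\,dx$. Then $u$ is (i.e. coincides almost everywhere with) a polynomial of degree strictly less than $2s$. -/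

import Mathlib

open MeasureTheory
open scoped FourierTransform Distributions

noncomputable section

/-- `(-Δ)^s f = 𝓕⁻¹ (|ξ|^{2s} 𝓕 f)` for a smooth and rapidly decaying function `f` on `ℝ^d`.
Mathlib's Fourier transform has the kernel `exp (-2πi ⟪x, ξ⟫)`, so that the symbol reads
`(2π|ξ|)^{2s}`; for `s = 1` this is the operator `-Δ = -∑ ∂_i²`. -/
def fracLaplacian {d : ℕ} (s : ℝ) (f : EuclideanSpace ℝ (Fin d) → ℂ) :
    EuclideanSpace ℝ (Fin d) → ℂ :=
  𝓕⁻ (fun ξ : EuclideanSpace ℝ (Fin d) => (((2 * Real.pi * ‖ξ‖) ^ (2 * s) : ℝ) : ℂ) * 𝓕 f ξ)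

/-- The weighted space of all `u ∈ L¹_loc(ℝ^d)` with `∫ |u(x)| / (1 + |x|)^{d + 2s} dx < ∞`. -/
def MemWeightedL1 {d : ℕ} (s : ℝ) (u : EuclideanSpace ℝ (Fin d) → ℝ) : Prop :=
  LocallyIntegrable u volume ∧
    Integrable (fun x => |u x| / (1 + ‖x‖) ^ ((d : ℝ) + 2 * s)) volume

/-- The pairing `⟨(-Δ)^s u, φ⟩ = ∫ u(x) (-Δ)^s φ(x) dx` of the distribution `(-Δ)^s u`
with a test function `φ` on the open set `Ω`. -/
def fracLaplacianPairing {d : ℕ} (s : ℝ) (u : EuclideanSpace ℝ (Fin d) → ℝ)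
    {Ω : TopologicalSpace.Opens (EuclideanSpace ℝ (Fin d))} (φ : 𝓓(Ω, ℝ)) : ℂ :=
  ∫ x, (u x : ℂ) * fracLaplacian s (fun y => ((φ y : ℝ) : ℂ)) x

/-- `(-Δ)^s u = T` in `𝓓'(Ω)`, for `u` in the weighted space and a distribution `T` on `Ω`. -/
def FracLaplacianEq {d : ℕ} (s : ℝ) (Ω : TopologicalSpace.Opens (EuclideanSpace ℝ (Fin d)))
    (u : EuclideanSpace ℝ (Fin d) → ℝ) (T : 𝓓'(Ω, ℝ)) : Prop :=
  ∀ φ : 𝓓(Ω, ℝ), fracLaplacianPairing s u φ = ((T φ : ℝ) : ℂ)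

end

/-!
Let `β = d + 2s`. A solution `u` is only known to satisfy `∫ |u(x)| (1 + ‖x‖) ^ (-β) < ∞`, so that
it may be paired exactly with the functions that are `O((1 + ‖x‖) ^ (-β))`.

*The pairing extends to Schwartz functions.* `(-Δ)^s` maps Schwartz functions continuously into the
functions that are `O((1 + ‖x‖) ^ (-β))`
(`exists_one_add_norm_rpow_mul_fracLaplacian_le`). With a smooth cutoff `χ` the symbol is split into
`χ(ξ) ‖ξ‖ ^ (2s)` and `(1 - χ(ξ)) ‖ξ‖ ^ (2s)`. The second part has temperate growth, hence acts on
Schwartz space. The first one is not smooth at the origin, but it is homogeneous there: subtracting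
its dyadic rescaling leaves a test function, so that its inverse Fourier transform `K` satisfies
`K(x) = 2 ^ (-β) K(x / 2) + (Schwartz function)`, which forces `K = O((1 + ‖x‖) ^ (-β))`
(`exists_one_add_norm_rpow_mul_le_of_dyadic`). As the test functions are dense in Schwartz space,
`∫ u (-Δ)^s φ = 0` for every Schwartz function `φ`
(`FracLaplacianEq.integral_smul_eq_zero`).

*The solution is its own mollification at every scale.* Let `η_R` have Fourier transform `χ(R ξ)`.
For a Schwartz function `ψ` the Fourier transform of `ψ - η_R * ψ` vanishes near the origin, so it
may be divided by the symbol: `ψ - η_R * ψ = (-Δ)^s φ` with `φ` Schwartz. Hence, for every `R > 0`,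
`u(y) = ∫ u(x) η_R(x - y) dx` for almost every `y` (`ae_eq_correlation_mollifier`).

*High derivatives vanish.* Differentiating this formula `k` times and using
`η_R(x) = R ^ (-d) η_1(x / R)`, a derivative of order `k` is at most `R ^ (2s - k)` times an integral
of `|u(x)| (R + ‖x - y‖) ^ (-β)`. For `k ≥ 2s` this tends to `0` as `R → ∞` by dominated convergence
(`correlation_lineDeriv_pow_mollifier_eq_zero`), and Taylor's formula along rays shows that `u` is a
polynomial of degree less than `2s`. No structure theorem for distributions supported at a point is
needed.
-/

open scoped SchwartzMap ContDiff
open Filter Topology Module LineDeriv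

/-! ### Powers of the norm away from the origin -/

section

variable {E : Type*} [NormedAddCommGroup E] [InnerProductSpace ℝ E]

/-- The smooth cutoff `χ` used throughout: `χ = 1` on the closed unit ball and `χ = 0` outside the
ball of radius `2`. -/
def unitCutoff (E : Type*) [NormedAddCommGroup E] [InnerProductSpace ℝ E] :
    ContDiffBump (0 : E) :=
  ⟨1, 2, one_pos, one_lt_two⟩

section

variable [HasContDiffBump E]

theorem unitCutoff_of_norm_le {x : E} (hx : ‖x‖ ≤ 1) : unitCutoff E x = 1 :=
  (unitCutoff E).one_of_mem_closedBall (by simpa [unitCutoff] using hx)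

theorem unitCutoff_of_le_norm {x : E} (hx : 2 ≤ ‖x‖) : unitCutoff E x = 0 :=
  (unitCutoff E).zero_of_le_dist (by simpa [unitCutoff] using hx)

end

variable [FiniteDimensional ℝ E]

theorem unitCutoff_hasTemperateGrowth : (unitCutoff E : E → ℝ).HasTemperateGrowth :=
  (unitCutoff E).hasCompactSupport.hasTemperateGrowth (unitCutoff E).contDiff

/-- Away from the origin every real power of the norm has temperate growth. With
`t = (1 + ‖ξ‖ ^ 2)⁻¹` one has `‖ξ‖ ^ a = (1 + ‖ξ‖ ^ 2) ^ (a / 2) * (1 - t) ^ (a / 2)`, and `t ≤ 1 / 2`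
where the cutoff factor does not vanish, so that the last factor is a smooth compactly supported
function of `t`. -/
theorem hasTemperateGrowth_one_sub_unitCutoff_mul_rpow (a : ℝ) :
    (fun ξ : E => (1 - unitCutoff E ξ) * ‖ξ‖ ^ a).HasTemperateGrowth := by
  let ρ : ContDiffBump (0 : ℝ) := ⟨1 / 2, 3 / 4, by norm_num, by norm_num⟩
  have hθ : (fun t : ℝ => ρ t * (1 - t) ^ (a / 2)).HasTemperateGrowth := by
    refine ρ.hasCompactSupport.mul_right.hasTemperateGrowth ?_
    rw [contDiff_iff_contDiffAt]
    intro t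
    by_cases ht : t < 1
    · exact ρ.contDiffAt.mul ((contDiffAt_const.sub contDiffAt_id).rpow_const_of_ne
        (sub_pos.2 ht).ne')
    · refine (contDiffAt_const (c := (0 : ℝ))).congr_of_eventuallyEq ?_
      filter_upwards [lt_mem_nhds (show 3 / 4 < t by linarith)] with x hx
      have : ρ x = 0 := ρ.zero_of_le_dist (by
        simpa [ρ] using hx.le.trans (le_abs_self x))
      simp [this]
  have h1 := Function.hasTemperateGrowth_one_add_norm_sq_rpow E (a / 2)
  have h2 := hθ.comp (Function.hasTemperateGrowth_one_add_norm_sq_rpow E (-1))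
  have h3 : (fun ξ : E => (1 - unitCutoff E ξ) * ((1 + ‖ξ‖ ^ 2) ^ (a / 2) *
      (ρ ((1 + ‖ξ‖ ^ 2) ^ (-1 : ℝ)) * (1 - (1 + ‖ξ‖ ^ 2) ^ (-1 : ℝ)) ^ (a / 2)))).HasTemperateGrowth :=
    ((Function.HasTemperateGrowth.const (1 : ℝ)).sub
      (unitCutoff_hasTemperateGrowth (E := E))).mul (h1.mul h2)
  refine (congrArg Function.HasTemperateGrowth (funext fun ξ => ?_)).mpr h3
  by_cases hξ : ‖ξ‖ ≤ 1
  · simp [unitCutoff_of_norm_le hξ]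
  push Not at hξ
  have h0 : 0 < 1 + ‖ξ‖ ^ 2 := by positivity
  have ht : (1 + ‖ξ‖ ^ 2)⁻¹ ≤ 1 / 2 := by
    rw [inv_le_comm₀ h0 (by norm_num)]; norm_num; nlinarith
  have hρ : ρ ((1 + ‖ξ‖ ^ 2)⁻¹) = 1 := ρ.one_of_mem_closedBall (by
    simpa [ρ, abs_of_pos (inv_pos.2 h0), abs_of_pos h0] using ht)
  rw [Real.rpow_neg_one, hρ, one_mul, ← Real.mul_rpow h0.le (by linarith)]
  congr 1
  rw [mul_sub, mul_inv_cancel₀ h0.ne', mul_one, add_sub_cancel_left, ← Real.rpow_natCast,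
    ← Real.rpow_mul (norm_nonneg _)]
  congr 1
  push_cast; ring

theorem hasTemperateGrowth_highFreqSymbol (a : ℝ) :
    (fun ξ : E => (((1 - unitCutoff E ξ) * ‖ξ‖ ^ a : ℝ) : ℂ)).HasTemperateGrowth :=
  Function.HasTemperateGrowth.comp (g := Complex.ofReal) Function.Complex.hasTemperateGrowth_ofReal
    (hasTemperateGrowth_one_sub_unitCutoff_mul_rpow a)

end

/-! ### Decay of the low-frequency kernel -/

section

/-- Decay from approximate self-similarity: if a bounded `f` agrees with `2 ^ (-β) * f (x / 2)` up
to an error `O(‖x‖ ^ (-β - 1))`, then `f` is `O((1 + ‖x‖) ^ (-β))`. The induction over dyadic balls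
carries the bound `‖x‖ ^ β * ‖f x‖ ≤ B - C / ‖x‖`, which reproduces itself exactly. -/
theorem exists_one_add_norm_rpow_mul_le_of_dyadic {E F : Type*} [NormedAddCommGroup E]
    [NormedSpace ℝ E] [NormedAddCommGroup F] [NormedSpace ℝ F] {f : E → F} {β B₀ C : ℝ}
    (hβ : 0 ≤ β) (hB : ∀ x, ‖f x‖ ≤ B₀)
    (hC : ∀ x, ‖x‖ ^ (β + 1) * ‖f x - (2 : ℝ) ^ (-β) • f ((2 : ℝ)⁻¹ • x)‖ ≤ C) :
    ∃ A, ∀ x, (1 + ‖x‖) ^ β * ‖f x‖ ≤ A := by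
  have hB0 : 0 ≤ B₀ := (norm_nonneg _).trans (hB 0)
  have hC0 : 0 ≤ C := le_trans (by positivity) (hC 0)
  have small : ∀ x, 1 / 2 ≤ ‖x‖ → ‖x‖ ≤ 1 → ‖x‖ ^ β * ‖f x‖ ≤ B₀ + 2 * C - C / ‖x‖ := by
    intro x h1 h2
    have h3 : ‖x‖ ^ β * ‖f x‖ ≤ 1 * B₀ :=
      mul_le_mul (Real.rpow_le_one (norm_nonneg _) h2 hβ) (hB x) (norm_nonneg _) zero_le_one
    have h4 : C / ‖x‖ ≤ 2 * C := by
      rw [div_le_iff₀ (by linarith)]; nlinarith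
    linarith
  have step : ∀ x, 0 < ‖x‖ → ‖x‖ ^ β * ‖f x‖ ≤
      ‖(2 : ℝ)⁻¹ • x‖ ^ β * ‖f ((2 : ℝ)⁻¹ • x)‖ + C / ‖x‖ := by
    intro x hx
    have h1 : ‖f x‖ ≤ (2 : ℝ) ^ (-β) * ‖f ((2 : ℝ)⁻¹ • x)‖ +
        ‖f x - (2 : ℝ) ^ (-β) • f ((2 : ℝ)⁻¹ • x)‖ := by
      have := norm_add_le ((2 : ℝ) ^ (-β) • f ((2 : ℝ)⁻¹ • x))
        (f x - (2 : ℝ) ^ (-β) • f ((2 : ℝ)⁻¹ • x))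
      rwa [add_sub_cancel, norm_smul, Real.norm_of_nonneg (by positivity)] at this
    have h2 : ‖x‖ ^ β * ‖f x - (2 : ℝ) ^ (-β) • f ((2 : ℝ)⁻¹ • x)‖ ≤ C / ‖x‖ := by
      rw [le_div_iff₀ hx]
      have := hC x
      rw [Real.rpow_add hx, Real.rpow_one] at this
      linarith
    have h3 : ‖(2 : ℝ)⁻¹ • x‖ ^ β = (2 : ℝ) ^ (-β) * ‖x‖ ^ β := by
      rw [norm_smul, Real.mul_rpow (norm_nonneg _) (norm_nonneg _), Real.norm_of_nonneg (by norm_num),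
        Real.inv_rpow (by norm_num), Real.rpow_neg (by norm_num)]
    rw [h3]
    have := mul_le_mul_of_nonneg_left h1 (show 0 ≤ ‖x‖ ^ β by positivity)
    linarith
  have key : ∀ n : ℕ, ∀ x, 1 / 2 ≤ ‖x‖ → ‖x‖ ≤ 2 ^ n →
      ‖x‖ ^ β * ‖f x‖ ≤ B₀ + 2 * C - C / ‖x‖ := by
    intro n
    induction n with
    | zero => intro x h1 h2; exact small x h1 (by simpa using h2)
    | succ n ih =>
      intro x h1 h2
      rcases le_total ‖x‖ 1 with h | h
      · exact small x h1 h
      have hn : ‖(2 : ℝ)⁻¹ • x‖ = ‖x‖ / 2 := by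
        rw [norm_smul, Real.norm_of_nonneg (by norm_num)]; ring
      have h3 := ih ((2 : ℝ)⁻¹ • x) (by rw [hn]; linarith) (by rw [hn]; rw [pow_succ] at h2; linarith)
      have h4 := step x (by linarith)
      have h5 : C / ‖(2 : ℝ)⁻¹ • x‖ = C / ‖x‖ + C / ‖x‖ := by
        rw [hn]; field_simp; norm_num
      linarith
  refine ⟨2 ^ β * (B₀ + 2 * C), fun x => ?_⟩
  rcases le_total ‖x‖ 1 with h | h
  · calc (1 + ‖x‖) ^ β * ‖f x‖ ≤ 2 ^ β * B₀ := by
          gcongr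
          · linarith
          · exact hB x
      _ ≤ _ := by gcongr; linarith
  · obtain ⟨n, hn⟩ := pow_unbounded_of_one_lt ‖x‖ one_lt_two
    have h1 := key n x (by linarith) hn.le
    calc (1 + ‖x‖) ^ β * ‖f x‖ ≤ (2 * ‖x‖) ^ β * ‖f x‖ := by gcongr; linarith
      _ = 2 ^ β * (‖x‖ ^ β * ‖f x‖) := by
        rw [Real.mul_rpow (by norm_num) (norm_nonneg _), mul_assoc]
      _ ≤ _ := by
        gcongr
        have : 0 ≤ C / ‖x‖ := by positivity
        linarith

/-- The Schwartz decay estimate with a real exponent. -/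
theorem SchwartzMap.exists_one_add_norm_rpow_mul_le {E F : Type*} [NormedAddCommGroup E]
    [NormedSpace ℝ E] [NormedAddCommGroup F] [NormedSpace ℝ F] (f : 𝓢(E, F)) (r : ℝ) :
    ∃ C, 0 ≤ C ∧ ∀ x, (1 + ‖x‖) ^ r * ‖f x‖ ≤ C := by
  obtain ⟨N, hN⟩ := exists_nat_ge r
  refine ⟨2 ^ N * (Finset.Iic (N, 0)).sup (fun m => SchwartzMap.seminorm ℝ m.1 m.2) f,
    by positivity, fun x => ?_⟩
  have h := SchwartzMap.one_add_le_sup_seminorm_apply (𝕜 := ℝ) (m := (N, 0)) le_rfl le_rfl f x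
  rw [norm_iteratedFDeriv_zero] at h
  refine le_trans ?_ h
  gcongr
  rw [← Real.rpow_natCast]
  exact Real.rpow_le_rpow_of_exponent_le (by simp) hN

/-- Peetre's inequality for the weight `(1 + ‖x‖) ^ β`. -/
theorem one_add_norm_rpow_le_mul {E : Type*} [NormedAddCommGroup E] {β : ℝ} (hβ : 0 ≤ β) (x y : E) :
    (1 + ‖x‖) ^ β ≤ (1 + ‖y‖) ^ β * (1 + ‖x - y‖) ^ β := by
  rw [← Real.mul_rpow (by positivity) (by positivity)]
  gcongr
  have := norm_add_le y (x - y)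
  rw [add_sub_cancel] at this
  nlinarith [norm_nonneg y, norm_nonneg (x - y)]

/-- A continuous operator on Schwartz space has polynomially decaying values, with constants
controlled by Schwartz seminorms. -/
theorem exists_one_add_norm_rpow_mul_clm_le {E : Type*} [NormedAddCommGroup E]
    [NormedSpace ℝ E] (T : 𝓢(E, ℂ) →L[ℂ] 𝓢(E, ℂ)) (β : ℝ) :
    ∃ (S : Finset (ℕ × ℕ)) (C : ℝ), 0 ≤ C ∧ ∀ (φ : 𝓢(E, ℂ)) (x : E),
      (1 + ‖x‖) ^ β * ‖T φ x‖ ≤ C * S.sup (schwartzSeminormFamily ℂ E ℂ) φ := by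
  obtain ⟨N, hN⟩ := exists_nat_ge β
  let q : Seminorm ℂ 𝓢(E, ℂ) :=
    ((Finset.Iic (N, 0)).sup (schwartzSeminormFamily ℂ E ℂ)).comp (T : 𝓢(E, ℂ) →ₗ[ℂ] 𝓢(E, ℂ))
  have hq : Continuous q :=
    ((schwartz_withSeminorms ℂ E ℂ).finset_sups.continuous_seminorm _).comp T.continuous
  obtain ⟨S, C, -, h⟩ := Seminorm.bound_of_continuous (schwartz_withSeminorms ℂ E ℂ) q hq
  refine ⟨S, 2 ^ N * C, by positivity, fun φ x => ?_⟩
  have h1 := SchwartzMap.one_add_le_sup_seminorm_apply (𝕜 := ℂ) (m := (N, 0)) le_rfl le_rfl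
    (T φ) x
  rw [norm_iteratedFDeriv_zero] at h1
  calc (1 + ‖x‖) ^ β * ‖T φ x‖ ≤ (1 + ‖x‖) ^ N * ‖T φ x‖ := by
        gcongr
        rw [← Real.rpow_natCast]
        exact Real.rpow_le_rpow_of_exponent_le (by simp) hN
    _ ≤ 2 ^ N * q φ := h1
    _ ≤ 2 ^ N * (C * S.sup (schwartzSeminormFamily ℂ E ℂ) φ) := by
        gcongr; exact h φ
    _ = _ := by ring

variable {E : Type*} [NormedAddCommGroup E] [InnerProductSpace ℝ E] [FiniteDimensional ℝ E]

/-- The low-frequency part `χ(ξ) ‖ξ‖ ^ a` of the symbol `‖ξ‖ ^ a`. -/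
noncomputable def lowFreqSymbol (E : Type*) [NormedAddCommGroup E] [InnerProductSpace ℝ E]
    [FiniteDimensional ℝ E] (a : ℝ) (ξ : E) : ℂ :=
  ((unitCutoff E ξ * ‖ξ‖ ^ a : ℝ) : ℂ)

theorem continuous_lowFreqSymbol {a : ℝ} (ha : 0 ≤ a) : Continuous (lowFreqSymbol E a) :=
  Complex.continuous_ofReal.comp
    ((unitCutoff E).continuous.mul (continuous_norm.rpow_const fun _ => Or.inr ha))

/-- The difference of the low-frequency symbol and its rescaling by `2` vanishes near the origin,
hence is a test function. -/
theorem exists_schwartzMap_eq_lowFreqSymbol_sub (a : ℝ) :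
    ∃ m : 𝓢(E, ℂ), ∀ ξ, m ξ =
      lowFreqSymbol E a ξ - (2 : ℝ) ^ (-a) • lowFreqSymbol E a ((2 : ℝ) • ξ) := by
  let g : E → ℝ := fun ξ => (1 - unitCutoff E ξ) * ‖ξ‖ ^ a
  have hg : ContDiff ℝ ∞ g := (hasTemperateGrowth_one_sub_unitCutoff_mul_rpow a).1
  let h : E → ℝ := fun ξ => unitCutoff E ξ * ((2 : ℝ) ^ (-a) * g ((2 : ℝ) • ξ))
  have hs : ContDiff ℝ ∞ h :=
    (unitCutoff E).contDiff.mul (contDiff_const.mul (hg.comp (contDiff_const_smul _)))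
  have hc : HasCompactSupport h := (unitCutoff E).hasCompactSupport.mul_right
  refine ⟨(hc.comp_left Complex.ofReal_zero).toSchwartzMap
    (Complex.ofRealCLM.contDiff.comp hs), fun ξ => ?_⟩
  have h2 : (2 : ℝ) ^ (-a) * ‖(2 : ℝ) • ξ‖ ^ a = ‖ξ‖ ^ a := by
    rw [norm_smul, Real.mul_rpow (norm_nonneg _) (norm_nonneg _), Real.norm_of_nonneg (by norm_num),
      ← mul_assoc, ← Real.rpow_add (by norm_num), neg_add_cancel, Real.rpow_zero, one_mul]
  -- `χ(2ξ) ≠ 0` forces `χ(ξ) = 1`.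
  have h3 : unitCutoff E ξ * unitCutoff E ((2 : ℝ) • ξ) = unitCutoff E ((2 : ℝ) • ξ) := by
    rcases le_total ‖ξ‖ 1 with hξ | hξ
    · rw [unitCutoff_of_norm_le hξ, one_mul]
    · rw [unitCutoff_of_le_norm (x := (2 : ℝ) • ξ), mul_zero]
      rw [norm_smul, Real.norm_of_nonneg (by norm_num)]; linarith
  have h4 : h ξ = unitCutoff E ξ * ‖ξ‖ ^ a -
      (2 : ℝ) ^ (-a) * (unitCutoff E ((2 : ℝ) • ξ) * ‖(2 : ℝ) • ξ‖ ^ a) := by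
    simp only [h, g]
    linear_combination (unitCutoff E ξ) * (1 - unitCutoff E ((2 : ℝ) • ξ)) * h2 -
      (‖ξ‖ ^ a) * h3 + unitCutoff E ((2 : ℝ) • ξ) * h2
  change ((h ξ : ℝ) : ℂ) = _
  rw [h4, lowFreqSymbol, lowFreqSymbol, Complex.real_smul]
  push_cast
  ring

variable [MeasurableSpace E] [BorelSpace E]

theorem fourierInv_comp_smul (f : E → ℂ) {R : ℝ} (hR : 0 < R) (x : E) :
    𝓕⁻ (fun ξ => f (R • ξ)) x = (R ^ finrank ℝ E)⁻¹ • 𝓕⁻ f (R⁻¹ • x) := by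
  rw [Real.fourierInv_eq, Real.fourierInv_eq]
  rw [← Measure.integral_comp_smul_of_nonneg volume _ R (hR := hR.le)]
  congr 1
  ext ξ
  rw [real_inner_smul_left, real_inner_smul_right, mul_inv_cancel_left₀ hR.ne']

theorem norm_fourierInv_le_integral_norm (f : E → ℂ) (x : E) : ‖𝓕⁻ f x‖ ≤ ∫ ξ, ‖f ξ‖ := by
  rw [Real.fourierInv_eq]
  exact (norm_integral_le_integral_norm _).trans_eq (by simp)

theorem integrable_lowFreqSymbol {a : ℝ} (ha : 0 ≤ a) : Integrable (lowFreqSymbol E a) := by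
  refine (continuous_lowFreqSymbol ha).integrable_of_hasCompactSupport ?_
  exact ((unitCutoff E).hasCompactSupport.mul_right (f' := fun ξ => ‖ξ‖ ^ a)).comp_left
    Complex.ofReal_zero

/-- The inverse Fourier transform of `χ(ξ) ‖ξ‖ ^ a` decays like `‖x‖ ^ (-n - a)`, where `n` is the
dimension, although the symbol is only finitely smooth at the origin. -/
theorem exists_one_add_norm_rpow_mul_fourierInv_lowFreqSymbol_le {a : ℝ} (ha : 0 ≤ a) :
    ∃ A, 0 ≤ A ∧
      ∀ x : E, (1 + ‖x‖) ^ ((finrank ℝ E : ℝ) + a) * ‖𝓕⁻ (lowFreqSymbol E a) x‖ ≤ A := by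
  obtain ⟨m, hm⟩ := exists_schwartzMap_eq_lowFreqSymbol_sub (E := E) a
  obtain ⟨C, -, hC⟩ := (𝓕⁻ m).exists_one_add_norm_rpow_mul_le ((finrank ℝ E : ℝ) + a + 1)
  have hself : ∀ x, 𝓕⁻ m x = 𝓕⁻ (lowFreqSymbol E a) x -
      (2 : ℝ) ^ (-((finrank ℝ E : ℝ) + a)) • 𝓕⁻ (lowFreqSymbol E a) ((2 : ℝ)⁻¹ • x) := by
    intro x
    have hint := integrable_lowFreqSymbol (E := E) ha
    have h1 : 𝓕⁻ (m : E → ℂ) x = 𝓕⁻ (lowFreqSymbol E a) x -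
        (2 : ℝ) ^ (-a) • 𝓕⁻ (fun ξ => lowFreqSymbol E a ((2 : ℝ) • ξ)) x := by
      simp_rw [Real.fourierInv_eq]
      rw [← integral_smul, ← integral_sub]
      · congr 1
        ext ξ
        rw [hm ξ, smul_sub, smul_comm]
      · exact (Real.fourierIntegral_convergent_iff (μ := volume) (-x) |>.2 hint).congr
          (by simp)
      · refine Integrable.smul _ ?_
        exact (Real.fourierIntegral_convergent_iff (μ := volume) (-x) |>.2
          (hint.comp_smul two_ne_zero)).congr (by simp)
    rw [SchwartzMap.fourierInv_coe, h1, fourierInv_comp_smul _ two_pos, smul_smul]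
    congr 2
    rw [neg_add, Real.rpow_add two_pos, Real.rpow_neg two_pos.le (finrank ℝ E : ℝ),
      Real.rpow_natCast, mul_comm]
  obtain ⟨A, hA⟩ := exists_one_add_norm_rpow_mul_le_of_dyadic
    (f := 𝓕⁻ (lowFreqSymbol E a)) (β := (finrank ℝ E : ℝ) + a) (C := C) (by positivity)
    (norm_fourierInv_le_integral_norm _) (fun x => by
      rw [← hself x]
      refine le_trans ?_ (hC x)
      gcongr
      simp)
  exact ⟨A, le_trans (by positivity) (hA 0), hA⟩

end

/-! ### The fractional Laplacian of a Schwartz function -/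

section

section

variable {E : Type*} [NormedAddCommGroup E] [InnerProductSpace ℝ E] [FiniteDimensional ℝ E]
  [MeasurableSpace E] [BorelSpace E]

/-- The multiplier with an integrable symbol is convolution with the inverse Fourier transform of the
symbol. -/
theorem fourierInv_mul_fourier_eq_integral {G : E → ℂ} (hG : Integrable G) (φ : 𝓢(E, ℂ)) (x : E) :
    𝓕⁻ (fun ξ => G ξ * 𝓕 (φ : E → ℂ) ξ) x = ∫ y, φ y * 𝓕⁻ G (x - y) := by
  have h1 : Integrable (fun ξ => Real.fourierChar (inner ℝ ξ x) • G ξ) :=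
    (Real.fourierIntegral_convergent_iff (μ := volume) (-x) |>.2 hG).congr (by simp)
  have h2 := VectorFourier.integral_fourierIntegral_smul_eq_flip (L := innerₗ E)
      Real.continuous_fourierChar continuous_inner (φ.integrable (μ := volume)) h1
  rw [Real.fourierInv_eq]
  calc _ = ∫ ξ, 𝓕 (φ : E → ℂ) ξ • (Real.fourierChar (inner ℝ ξ x) • G ξ) := by
        congr 1; ext ξ
        simp only [Circle.smul_def, smul_eq_mul]; ring
    _ = _ := h2
    _ = _ := by
        congr 1; ext y
        rw [smul_eq_mul, Real.fourierInv_eq]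
        congr 1
        simp only [VectorFourier.fourierIntegral]
        congr 1; ext ξ
        rw [smul_smul, ← AddChar.map_add_eq_mul]
        congr 2
        simp [inner_sub_right, real_inner_comm]
        ring

/-- Convolution with a Schwartz function preserves polynomial decay of any order, with a
constant controlled by Schwartz seminorms. -/
theorem exists_one_add_norm_rpow_mul_convolution_le {k : E → ℂ} {β A : ℝ} (hβ : 0 ≤ β)
    (hk : ∀ x, (1 + ‖x‖) ^ β * ‖k x‖ ≤ A) :
    ∃ (S : Finset (ℕ × ℕ)) (C : ℝ), 0 ≤ C ∧ ∀ (φ : 𝓢(E, ℂ)) (x : E),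
      (1 + ‖x‖) ^ β * ‖∫ y, φ y * k (x - y)‖ ≤ C * S.sup (schwartzSeminormFamily ℂ E ℂ) φ := by
  have hA : 0 ≤ A := le_trans (by positivity) (hk 0)
  obtain ⟨N, hN⟩ := exists_nat_gt (β + finrank ℝ E)
  have hint : Integrable (fun y : E => (1 + ‖y‖) ^ (-(N - β))) :=
    integrable_one_add_norm (by linarith)
  refine ⟨Finset.Iic (N, 0), 2 ^ N * A * ∫ y : E, (1 + ‖y‖) ^ (-(N - β)),
    mul_nonneg (by positivity) (integral_nonneg fun y => by positivity), fun φ x => ?_⟩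
  set p := (Finset.Iic (N, 0)).sup (schwartzSeminormFamily ℂ E ℂ) φ with hp
  have hφ : ∀ y, ‖φ y‖ ≤ 2 ^ N * p * (1 + ‖y‖) ^ (-(N : ℝ)) := by
    intro y
    have h := SchwartzMap.one_add_le_sup_seminorm_apply (𝕜 := ℂ) (m := (N, 0)) le_rfl le_rfl φ y
    rw [norm_iteratedFDeriv_zero] at h
    rw [Real.rpow_neg (by positivity), Real.rpow_natCast, ← div_eq_mul_inv,
      le_div_iff₀ (by positivity), mul_comm]
    exact h
  have hb : ∀ y, ‖(((1 + ‖x‖) ^ β : ℝ) : ℂ) * (φ y * k (x - y))‖ ≤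
      2 ^ N * p * A * (1 + ‖y‖) ^ (-(N - β)) := by
    intro y
    have h1 := one_add_norm_rpow_le_mul hβ x y
    have h2 : (1 + ‖y‖) ^ (-(N - β)) = (1 + ‖y‖) ^ β * (1 + ‖y‖) ^ (-(N : ℝ)) := by
      rw [← Real.rpow_add (by positivity)]; ring_nf
    rw [norm_mul, norm_mul, Complex.norm_real, Real.norm_of_nonneg (by positivity)]
    calc (1 + ‖x‖) ^ β * (‖φ y‖ * ‖k (x - y)‖)
        ≤ ((1 + ‖y‖) ^ β * (1 + ‖x - y‖) ^ β) * (‖φ y‖ * ‖k (x - y)‖) := by gcongr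
      _ = (1 + ‖y‖) ^ β * ‖φ y‖ * ((1 + ‖x - y‖) ^ β * ‖k (x - y)‖) := by ring
      _ ≤ (1 + ‖y‖) ^ β * (2 ^ N * p * (1 + ‖y‖) ^ (-(N : ℝ))) * A := by
          gcongr
          · exact hφ y
          · exact hk _
      _ = _ := by rw [h2]; ring
  have h := norm_integral_le_of_norm_le (hint.const_mul _) (Eventually.of_forall hb)
  rw [integral_const_mul, norm_mul, Complex.norm_real, Real.norm_of_nonneg (by positivity),
    integral_const_mul] at h
  linarith

/-- The multiplier with the high-frequency symbol `(1 - χ(ξ)) ‖ξ‖ ^ a`. -/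
noncomputable def highFreqMultiplier (E : Type*) [NormedAddCommGroup E] [InnerProductSpace ℝ E]
    [FiniteDimensional ℝ E] [MeasurableSpace E] [BorelSpace E] (a : ℝ) : 𝓢(E, ℂ) →L[ℂ] 𝓢(E, ℂ) :=
  SchwartzMap.fourierMultiplierCLM ℂ
    (fun ξ => (((1 - unitCutoff E ξ) * ‖ξ‖ ^ a : ℝ) : ℂ))

theorem highFreqMultiplier_apply (a : ℝ) (φ : 𝓢(E, ℂ)) (x : E) :
    highFreqMultiplier E a φ x =
      𝓕⁻ (fun ξ => (((1 - unitCutoff E ξ) * ‖ξ‖ ^ a : ℝ) : ℂ) * 𝓕 (φ : E → ℂ) ξ) x := by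
  rw [highFreqMultiplier, SchwartzMap.fourierMultiplierCLM_apply, SchwartzMap.fourierInv_coe,
    SchwartzMap.smulLeftCLM_apply (hasTemperateGrowth_highFreqSymbol a), SchwartzMap.fourier_coe]
  rfl

theorem integrable_lowFreqSymbol_mul_fourier {a : ℝ} (ha : 0 ≤ a) (φ : 𝓢(E, ℂ)) :
    Integrable (fun ξ => lowFreqSymbol E a ξ * 𝓕 (φ : E → ℂ) ξ) :=
  (integrable_lowFreqSymbol ha).mul_bdd (c := SchwartzMap.seminorm ℝ 0 0 (𝓕 φ))
    (𝓕 φ).continuous.aestronglyMeasurable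
    (Eventually.of_forall fun ξ => (𝓕 φ).norm_le_seminorm ℝ ξ)

theorem integrable_highFreqSymbol_mul_fourier (a : ℝ) (φ : 𝓢(E, ℂ)) :
    Integrable (fun ξ => (((1 - unitCutoff E ξ) * ‖ξ‖ ^ a : ℝ) : ℂ) * 𝓕 (φ : E → ℂ) ξ) := by
  refine (SchwartzMap.smulLeftCLM ℂ (fun ξ : E => (((1 - unitCutoff E ξ) * ‖ξ‖ ^ a : ℝ) : ℂ))
    (𝓕 φ)).integrable.congr (Eventually.of_forall fun ξ => ?_)
  exact SchwartzMap.smulLeftCLM_apply_apply (hasTemperateGrowth_highFreqSymbol a) _ ξ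

theorem fourierInv_add_apply {f g : E → ℂ} (hf : Integrable f) (hg : Integrable g) (x : E) :
    𝓕⁻ (fun ξ => f ξ + g ξ) x = 𝓕⁻ f x + 𝓕⁻ g x := by
  simp_rw [Real.fourierInv_eq]
  rw [← integral_add]
  · simp_rw [smul_add]
  · exact (Real.fourierIntegral_convergent_iff (μ := volume) (-x) |>.2 hf).congr (by simp)
  · exact (Real.fourierIntegral_convergent_iff (μ := volume) (-x) |>.2 hg).congr (by simp)

theorem fourierInv_const_mul_apply (c : ℂ) (f : E → ℂ) (x : E) :
    𝓕⁻ (fun ξ => c * f ξ) x = c * 𝓕⁻ f x := by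
  simp_rw [Real.fourierInv_eq, ← integral_const_mul]
  simp_rw [Circle.smul_def, smul_eq_mul, mul_left_comm]

end

variable {d : ℕ} {s : ℝ}

local notation "𝔼" => EuclideanSpace ℝ (Fin d)

theorem fracLaplacian_symbol_eq (φ : 𝓢(𝔼, ℂ)) (ξ : 𝔼) :
    (((2 * Real.pi * ‖ξ‖) ^ (2 * s) : ℝ) : ℂ) * 𝓕 (φ : 𝔼 → ℂ) ξ =
      (((2 * Real.pi) ^ (2 * s) : ℝ) : ℂ) * (lowFreqSymbol 𝔼 (2 * s) ξ * 𝓕 (φ : 𝔼 → ℂ) ξ +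
        (((1 - unitCutoff 𝔼 ξ) * ‖ξ‖ ^ (2 * s) : ℝ) : ℂ) * 𝓕 (φ : 𝔼 → ℂ) ξ) := by
  rw [Real.mul_rpow (by positivity) (norm_nonneg _), lowFreqSymbol]
  push_cast
  ring

theorem integrable_fracLaplacian_symbol (hs : 0 ≤ s) (φ : 𝓢(𝔼, ℂ)) :
    Integrable (fun ξ => (((2 * Real.pi * ‖ξ‖) ^ (2 * s) : ℝ) : ℂ) * 𝓕 (φ : 𝔼 → ℂ) ξ) := by
  simp_rw [fracLaplacian_symbol_eq]
  exact ((integrable_lowFreqSymbol_mul_fourier (by linarith) φ).add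
    (integrable_highFreqSymbol_mul_fourier _ φ)).const_mul _

theorem continuous_fracLaplacian (hs : 0 ≤ s) (φ : 𝓢(𝔼, ℂ)) : Continuous (fracLaplacian s φ) := by
  have h := VectorFourier.fourierIntegral_continuous (L := -innerₗ 𝔼) (μ := volume)
    Real.continuous_fourierChar (by simpa using! continuous_inner.neg)
    (integrable_fracLaplacian_symbol hs φ)
  exact h

theorem fracLaplacian_eq_low_add_high (hs : 0 ≤ s) (φ : 𝓢(𝔼, ℂ)) (x : 𝔼) :
    fracLaplacian s φ x = (((2 * Real.pi) ^ (2 * s) : ℝ) : ℂ) *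
      ((∫ y, φ y * 𝓕⁻ (lowFreqSymbol 𝔼 (2 * s)) (x - y)) + highFreqMultiplier 𝔼 (2 * s) φ x) := by
  rw [fracLaplacian, ← fourierInv_mul_fourier_eq_integral (integrable_lowFreqSymbol (by linarith)),
    highFreqMultiplier_apply, ← fourierInv_add_apply
      (integrable_lowFreqSymbol_mul_fourier (by linarith) φ)
      (integrable_highFreqSymbol_mul_fourier _ φ), ← fourierInv_const_mul_apply]
  simp_rw [fracLaplacian_symbol_eq]

/-- `(-Δ)^s` maps Schwartz functions continuously into the functions that are
`O((1 + ‖x‖) ^ (-d - 2s))`; the non-smoothness of the symbol at the origin permits no better. -/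
theorem exists_one_add_norm_rpow_mul_fracLaplacian_le (hs : 0 ≤ s) :
    ∃ (S : Finset (ℕ × ℕ)) (C : ℝ), 0 ≤ C ∧ ∀ (φ : 𝓢(𝔼, ℂ)) (x : 𝔼),
      (1 + ‖x‖) ^ ((d : ℝ) + 2 * s) * ‖fracLaplacian s φ x‖ ≤
        C * S.sup (schwartzSeminormFamily ℂ 𝔼 ℂ) φ := by
  obtain ⟨A, hA0, hA⟩ :=
    exists_one_add_norm_rpow_mul_fourierInv_lowFreqSymbol_le (E := 𝔼) (a := 2 * s) (by linarith)
  rw [finrank_euclideanSpace_fin] at hA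
  obtain ⟨S₁, C₁, hC₁, h₁⟩ := exists_one_add_norm_rpow_mul_convolution_le
    (by positivity) hA
  obtain ⟨S₂, C₂, hC₂, h₂⟩ := exists_one_add_norm_rpow_mul_clm_le
    (highFreqMultiplier 𝔼 (2 * s)) ((d : ℝ) + 2 * s)
  refine ⟨S₁ ∪ S₂, (2 * Real.pi) ^ (2 * s) * (C₁ + C₂), by positivity, fun φ x => ?_⟩
  have m₁ : S₁.sup (schwartzSeminormFamily ℂ 𝔼 ℂ) φ ≤
      (S₁ ∪ S₂).sup (schwartzSeminormFamily ℂ 𝔼 ℂ) φ :=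
    Seminorm.le_def.1 (Finset.sup_mono Finset.subset_union_left) φ
  have m₂ : S₂.sup (schwartzSeminormFamily ℂ 𝔼 ℂ) φ ≤
      (S₁ ∪ S₂).sup (schwartzSeminormFamily ℂ 𝔼 ℂ) φ :=
    Seminorm.le_def.1 (Finset.sup_mono Finset.subset_union_right) φ
  rw [fracLaplacian_eq_low_add_high hs, norm_mul, Complex.norm_real,
    Real.norm_of_nonneg (by positivity)]
  set c := (2 * Real.pi) ^ (2 * s)
  set w := (1 + ‖x‖) ^ ((d : ℝ) + 2 * s)
  set p := (S₁ ∪ S₂).sup (schwartzSeminormFamily ℂ 𝔼 ℂ) φ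
  have hc : 0 ≤ c := by positivity
  have hw : 0 ≤ w := by positivity
  calc _ ≤ w * (c * (‖∫ y, φ y * 𝓕⁻ (lowFreqSymbol 𝔼 (2 * s)) (x - y)‖ +
        ‖highFreqMultiplier 𝔼 (2 * s) φ x‖)) := by gcongr; exact norm_add_le _ _
    _ = c * (w * ‖∫ y, φ y * 𝓕⁻ (lowFreqSymbol 𝔼 (2 * s)) (x - y)‖ +
        w * ‖highFreqMultiplier 𝔼 (2 * s) φ x‖) := by ring
    _ ≤ c * (C₁ * p + C₂ * p) := by
        refine mul_le_mul_of_nonneg_left (add_le_add ?_ ?_) hc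
        · exact (h₁ φ x).trans (by gcongr)
        · exact (h₂ φ x).trans (by gcongr)
    _ = _ := by ring

theorem fracLaplacian_add (hs : 0 ≤ s) (φ ψ : 𝓢(𝔼, ℂ)) (x : 𝔼) :
    fracLaplacian s (φ + ψ : 𝓢(𝔼, ℂ)) x = fracLaplacian s φ x + fracLaplacian s ψ x := by
  rw [fracLaplacian, fracLaplacian, fracLaplacian, ← fourierInv_add_apply
    (integrable_fracLaplacian_symbol hs φ) (integrable_fracLaplacian_symbol hs ψ)]
  refine congrFun (congrArg _ (funext fun ξ => ?_)) x
  rw [← SchwartzMap.fourier_coe, FourierTransform.fourier_add, ← SchwartzMap.fourier_coe,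
    ← SchwartzMap.fourier_coe, add_apply, mul_add]

theorem fracLaplacian_smul (c : ℂ) (φ : 𝓢(𝔼, ℂ)) (x : 𝔼) :
    fracLaplacian s (c • φ : 𝓢(𝔼, ℂ)) x = c * fracLaplacian s φ x := by
  rw [fracLaplacian, fracLaplacian, ← fourierInv_const_mul_apply]
  refine congrFun (congrArg _ (funext fun ξ => ?_)) x
  rw [← SchwartzMap.fourier_coe, FourierTransform.fourier_smul, ← SchwartzMap.fourier_coe,
    smul_apply, smul_eq_mul, mul_left_comm]

end

/-! ### Testing against Schwartz functions -/

section

section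

variable {E : Type*} [NormedAddCommGroup E] [InnerProductSpace ℝ E]

theorem hasTemperateGrowth_dilate {F : Type*} [NormedAddCommGroup F] [NormedSpace ℝ F] {h : E → F}
    (hh : h.HasTemperateGrowth) (R : ℝ) : (fun x => h (R • x)).HasTemperateGrowth :=
  Function.HasTemperateGrowth.comp (g := h) (f := fun x => R • x) hh
    (ContinuousLinearMap.hasTemperateGrowth (R • ContinuousLinearMap.id ℝ E))

/-- If `h` vanishes on the unit ball, then `h (x / R) • φ` is `O(1 / R)` in every Schwartz seminorm:
it lives on `R ≤ ‖x‖`, where one power of `1 + ‖x‖` can be traded for `1 / R`. -/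
theorem exists_seminorm_smulLeftCLM_dilate_le {h : E → ℂ} (hh : h.HasTemperateGrowth)
    (h0 : ∀ x, ‖x‖ ≤ 1 → h x = 0) (φ : 𝓢(E, ℂ)) (k n : ℕ) :
    ∃ C, 0 ≤ C ∧ ∀ R : ℝ, 1 ≤ R →
      SchwartzMap.seminorm ℂ k n (SchwartzMap.smulLeftCLM ℂ (fun x => h (R⁻¹ • x)) φ) ≤ C / R := by
  obtain ⟨l, D, hD0, hD⟩ := hh.norm_iteratedFDeriv_le_uniform n
  set p := (Finset.Iic (k + l + 1, n)).sup (fun m => SchwartzMap.seminorm ℂ m.1 m.2) φ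
  refine ⟨∑ i ∈ Finset.range (n + 1), (n.choose i : ℝ) * D * (2 ^ (k + l + 1) * p),
    Finset.sum_nonneg fun i _ => by positivity, fun R hR => ?_⟩
  have hR0 : 0 < R := by linarith
  refine SchwartzMap.seminorm_le_bound _ _ _ _
    (div_nonneg (Finset.sum_nonneg fun i _ => by positivity) hR0.le) fun x => ?_
  rw [SchwartzMap.smulLeftCLM_apply (hasTemperateGrowth_dilate hh R⁻¹)]
  rcases lt_or_ge ‖x‖ R with hx | hx
  · have : x ∉ tsupport (fun x => h (R⁻¹ • x) • φ x) := by
      rw [notMem_tsupport_iff_eventuallyEq]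
      filter_upwards [continuous_norm.continuousAt.eventually (gt_mem_nhds hx)] with y hy
      rw [h0, zero_smul, Pi.zero_apply]
      rw [norm_smul, norm_inv, Real.norm_of_nonneg hR0.le, inv_mul_le_iff₀ hR0, mul_one]
      exact hy.le
    have h2 : iteratedFDeriv ℝ n (fun x => h (R⁻¹ • x) • φ x) x = 0 := by
      by_contra hne
      exact this (support_iteratedFDeriv_subset n hne)
    rw [h2, norm_zero, mul_zero]
    exact div_nonneg (Finset.sum_nonneg fun i _ => by positivity) hR0.le
  have h1 := norm_iteratedFDeriv_smul_le (𝕜 := ℝ) (hasTemperateGrowth_dilate hh R⁻¹).1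
    (φ.smooth ⊤) x (n := n) (mod_cast le_top)
  have h2 : ∀ i ∈ Finset.range (n + 1), ‖x‖ ^ k * ((n.choose i : ℝ) *
      ‖iteratedFDeriv ℝ i (fun x => h (R⁻¹ • x)) x‖ * ‖iteratedFDeriv ℝ (n - i) φ x‖) ≤
      (n.choose i : ℝ) * D * (2 ^ (k + l + 1) * p) / R := by
    intro i hi
    have hi' : i ≤ n := Nat.lt_succ_iff.1 (Finset.mem_range.1 hi)
    have hR1 : R⁻¹ ≤ 1 := inv_le_one_of_one_le₀ hR
    have e1 : ‖iteratedFDeriv ℝ i (fun x => h (R⁻¹ • x)) x‖ ≤ D * (1 + ‖x‖) ^ l := by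
      rw [iteratedFDeriv_comp_const_smul _ (hh.1.of_le (mod_cast le_top)), norm_smul, norm_pow,
        norm_inv, Real.norm_of_nonneg hR0.le]
      calc R⁻¹ ^ i * ‖iteratedFDeriv ℝ i h (R⁻¹ • x)‖ ≤ 1 * (D * (1 + ‖R⁻¹ • x‖) ^ l) := by
            gcongr
            · exact pow_le_one₀ (by positivity) hR1
            · exact hD i hi' _
        _ ≤ D * (1 + ‖x‖) ^ l := by
            rw [one_mul, norm_smul, norm_inv, Real.norm_of_nonneg hR0.le]
            gcongr
            exact mul_le_of_le_one_left (norm_nonneg _) hR1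
    have e2 : (1 + ‖x‖) ^ (k + l + 1) * ‖iteratedFDeriv ℝ (n - i) φ x‖ ≤ 2 ^ (k + l + 1) * p :=
      SchwartzMap.one_add_le_sup_seminorm_apply (𝕜 := ℂ) (m := (k + l + 1, n)) le_rfl
        (Nat.sub_le n i) φ x
    rw [le_div_iff₀ hR0]
    calc ‖x‖ ^ k * ((n.choose i : ℝ) * ‖iteratedFDeriv ℝ i (fun x => h (R⁻¹ • x)) x‖ *
          ‖iteratedFDeriv ℝ (n - i) φ x‖) * R
        ≤ (1 + ‖x‖) ^ k * ((n.choose i : ℝ) * (D * (1 + ‖x‖) ^ l) *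
          ‖iteratedFDeriv ℝ (n - i) φ x‖) * (1 + ‖x‖) := by
          gcongr
          · linarith
          · linarith
      _ = (n.choose i : ℝ) * D * ((1 + ‖x‖) ^ (k + l + 1) * ‖iteratedFDeriv ℝ (n - i) φ x‖) := by
          ring
      _ ≤ _ := by gcongr
  calc _ ≤ ‖x‖ ^ k * ∑ i ∈ Finset.range (n + 1), (n.choose i : ℝ) *
        ‖iteratedFDeriv ℝ i (fun x => h (R⁻¹ • x)) x‖ * ‖iteratedFDeriv ℝ (n - i) φ x‖ := by
        gcongr
    _ ≤ _ := by
        rw [Finset.mul_sum, Finset.sum_div]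
        exact Finset.sum_le_sum h2

end

variable {d : ℕ} {s : ℝ} {u : EuclideanSpace ℝ (Fin d) → ℝ}

local notation "𝔼" => EuclideanSpace ℝ (Fin d)

/-- The weighted space pairs with the functions that are `O((1 + ‖x‖) ^ (-d - 2s))`. -/
theorem MemWeightedL1.integrable_smul {F : Type*} [NormedAddCommGroup F] [NormedSpace ℝ F]
    (hu : MemWeightedL1 s u) {f : 𝔼 → F} (hf : AEStronglyMeasurable f) {A : ℝ}
    (hA : ∀ x, (1 + ‖x‖) ^ ((d : ℝ) + 2 * s) * ‖f x‖ ≤ A) :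
    Integrable (fun x => u x • f x) := by
  refine (hu.2.const_mul A).mono' (hu.1.aestronglyMeasurable.smul hf) (Eventually.of_forall fun x => ?_)
  rw [norm_smul, Real.norm_eq_abs, mul_div_assoc', le_div_iff₀ (by positivity)]
  nlinarith [hA x, abs_nonneg (u x)]

theorem MemWeightedL1.norm_integral_smul_le {F : Type*} [NormedAddCommGroup F] [NormedSpace ℝ F]
    (hu : MemWeightedL1 s u) {f : 𝔼 → F} {A : ℝ}
    (hA : ∀ x, (1 + ‖x‖) ^ ((d : ℝ) + 2 * s) * ‖f x‖ ≤ A) :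
    ‖∫ x, u x • f x‖ ≤ A * ∫ x, |u x| / (1 + ‖x‖) ^ ((d : ℝ) + 2 * s) := by
  rw [← integral_const_mul]
  refine norm_integral_le_of_norm_le (hu.2.const_mul A) (Eventually.of_forall fun x => ?_)
  rw [norm_smul, Real.norm_eq_abs, mul_div_assoc', le_div_iff₀ (by positivity)]
  nlinarith [hA x, abs_nonneg (u x)]

theorem MemWeightedL1.integrable_smul_fracLaplacian (hs : 0 ≤ s) (hu : MemWeightedL1 s u)
    (φ : 𝓢(𝔼, ℂ)) : Integrable (fun x => u x • fracLaplacian s φ x) := by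
  obtain ⟨S, C, -, h⟩ := exists_one_add_norm_rpow_mul_fracLaplacian_le (d := d) hs
  exact hu.integrable_smul (continuous_fracLaplacian hs φ).aestronglyMeasurable (h φ)

/-- A weak solution annihilates `(-Δ)^s φ` for every compactly supported complex-valued `φ`. -/
theorem FracLaplacianEq.integral_smul_eq_zero_of_hasCompactSupport (hs : 0 ≤ s)
    (hu : MemWeightedL1 s u) (hsol : FracLaplacianEq s ⊤ u 0) (φ : 𝓢(𝔼, ℂ))
    (hφ : HasCompactSupport φ) : ∫ x, u x • fracLaplacian s φ x = 0 := by
  have key : ∀ (g : 𝔼 → ℝ) (hg : ContDiff ℝ ∞ g) (hc : HasCompactSupport g),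
      ∫ x, u x • fracLaplacian s (fun y => ((g y : ℝ) : ℂ)) x = 0 := by
    intro g hg hc
    have h := hsol ⟨g, hg, hc, by simp⟩
    simp only [fracLaplacianPairing] at h
    simp_rw [Complex.real_smul]
    exact h
  have hre : ContDiff ℝ ∞ (fun x => (φ x).re) := Complex.reCLM.contDiff.comp (φ.smooth ⊤)
  have him : ContDiff ℝ ∞ (fun x => (φ x).im) := Complex.imCLM.contDiff.comp (φ.smooth ⊤)
  have cre : HasCompactSupport (fun x => (φ x).re) := hφ.comp_left Complex.zero_re
  have cim : HasCompactSupport (fun x => (φ x).im) := hφ.comp_left Complex.zero_im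
  let φ₁ : 𝓢(𝔼, ℂ) := (cre.comp_left Complex.ofReal_zero).toSchwartzMap
    (Complex.ofRealCLM.contDiff.comp hre)
  let φ₂ : 𝓢(𝔼, ℂ) := (cim.comp_left Complex.ofReal_zero).toSchwartzMap
    (Complex.ofRealCLM.contDiff.comp him)
  have hsum : φ = φ₁ + Complex.I • φ₂ := by
    ext x
    rw [add_apply, smul_apply, smul_eq_mul, mul_comm]
    exact (Complex.re_add_im (φ x)).symm
  have i₁ : ∫ x, u x • fracLaplacian s φ₁ x = 0 := key _ hre cre
  have i₂ : ∫ x, u x • fracLaplacian s φ₂ x = 0 := key _ him cim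
  rw [hsum]
  have e : ∀ x, u x • fracLaplacian s (φ₁ + Complex.I • φ₂ : 𝓢(𝔼, ℂ)) x =
      u x • fracLaplacian s φ₁ x + Complex.I * (u x • fracLaplacian s φ₂ x) := by
    intro x
    rw [fracLaplacian_add hs, fracLaplacian_smul, smul_add, mul_smul_comm]
  simp_rw [e]
  rw [integral_add (hu.integrable_smul_fracLaplacian hs φ₁)
    ((hu.integrable_smul_fracLaplacian hs φ₂).const_mul _), integral_const_mul, i₁, i₂]
  simp

/-- A weak solution annihilates `(-Δ)^s φ` for every Schwartz function `φ`, by density of the test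
functions and continuity of the pairing. -/
theorem FracLaplacianEq.integral_smul_eq_zero (hs : 0 ≤ s) (hu : MemWeightedL1 s u)
    (hsol : FracLaplacianEq s ⊤ u 0) (φ : 𝓢(𝔼, ℂ)) :
    ∫ x, u x • fracLaplacian s φ x = 0 := by
  obtain ⟨S, C, hC, h⟩ := exists_one_add_norm_rpow_mul_fracLaplacian_le (d := d) hs
  let h₁ : 𝔼 → ℂ := fun x => ((1 - unitCutoff 𝔼 x : ℝ) : ℂ)
  let h₂ : 𝔼 → ℂ := fun x => ((unitCutoff 𝔼 x : ℝ) : ℂ)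
  have t₁ : h₁.HasTemperateGrowth :=
    Function.HasTemperateGrowth.comp (g := Complex.ofReal) Function.Complex.hasTemperateGrowth_ofReal
      ((Function.HasTemperateGrowth.const (1 : ℝ)).sub unitCutoff_hasTemperateGrowth)
  have t₂ : h₂.HasTemperateGrowth :=
    Function.HasTemperateGrowth.comp (g := Complex.ofReal) Function.Complex.hasTemperateGrowth_ofReal
      unitCutoff_hasTemperateGrowth
  choose D hD0 hD using fun m : ℕ × ℕ => exists_seminorm_smulLeftCLM_dilate_le t₁
    (fun x hx => by simp [h₁, unitCutoff_of_norm_le hx]) φ m.1 m.2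
  set I := ∫ x, |u x| / (1 + ‖x‖) ^ ((d : ℝ) + 2 * s)
  have hI : 0 ≤ I := integral_nonneg fun x => by positivity
  have hb : ∀ R : ℝ, 1 ≤ R → ‖∫ x, u x • fracLaplacian s φ x‖ ≤ C * (∑ m ∈ S, D m) * I / R := by
    intro R hR
    have hR0 : 0 < R := by linarith
    let φ₁ := SchwartzMap.smulLeftCLM ℂ (fun x => h₁ (R⁻¹ • x)) φ
    let φ₂ := SchwartzMap.smulLeftCLM ℂ (fun x => h₂ (R⁻¹ • x)) φ
    have hsum : φ = φ₁ + φ₂ := by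
      ext x
      rw [add_apply, SchwartzMap.smulLeftCLM_apply_apply (hasTemperateGrowth_dilate t₁ R⁻¹),
        SchwartzMap.smulLeftCLM_apply_apply (hasTemperateGrowth_dilate t₂ R⁻¹)]
      simp [h₁, h₂]
      ring
    have hc : HasCompactSupport φ₂ := by
      have : HasCompactSupport (fun x : 𝔼 => unitCutoff 𝔼 (R⁻¹ • x)) :=
        (unitCutoff 𝔼).hasCompactSupport.comp_smul (inv_ne_zero hR0.ne')
      rw [SchwartzMap.smulLeftCLM_apply (hasTemperateGrowth_dilate t₂ R⁻¹)]
      exact (this.comp_left Complex.ofReal_zero).smul_right (f' := φ)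
    have z := FracLaplacianEq.integral_smul_eq_zero_of_hasCompactSupport hs hu hsol φ₂ hc
    have e : ∫ x, u x • fracLaplacian s φ x = ∫ x, u x • fracLaplacian s φ₁ x := by
      conv_lhs => rw [hsum]
      simp_rw [fracLaplacian_add hs, smul_add]
      rw [integral_add (hu.integrable_smul_fracLaplacian hs φ₁)
        (hu.integrable_smul_fracLaplacian hs φ₂), z, add_zero]
    have hp : S.sup (schwartzSeminormFamily ℂ 𝔼 ℂ) φ₁ ≤ (∑ m ∈ S, D m) / R := by
      refine Seminorm.finset_sup_apply_le (div_nonneg (Finset.sum_nonneg fun m _ => hD0 m) hR0.le)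
        fun m hm => (hD m R hR).trans ?_
      gcongr
      exact Finset.single_le_sum (fun m _ => hD0 m) hm
    rw [e]
    refine (hu.norm_integral_smul_le fun x => (h φ₁ x).trans
      (mul_le_mul_of_nonneg_left hp hC)).trans_eq ?_
    ring
  have hlim : Tendsto (fun R : ℝ => C * (∑ m ∈ S, D m) * I / R) atTop (𝓝 0) :=
    tendsto_const_nhds.div_atTop tendsto_id
  have := ge_of_tendsto hlim ((eventually_ge_atTop 1).mono hb)
  exact norm_le_zero_iff.1 this

end

/-! ### Mollifiers with Fourier transform equal to one near the origin -/

section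

section

variable {E : Type*} [NormedAddCommGroup E] [InnerProductSpace ℝ E] [FiniteDimensional ℝ E]

/-- The dilated cutoff `ξ ↦ χ(R ξ)` as a Schwartz function. -/
noncomputable def dilatedCutoff (E : Type*) [NormedAddCommGroup E] [InnerProductSpace ℝ E]
    [FiniteDimensional ℝ E] (R : ℝ) (hR : R ≠ 0) : 𝓢(E, ℂ) :=
  (((unitCutoff E).hasCompactSupport.comp_smul hR).comp_left Complex.ofReal_zero).toSchwartzMap
    (Complex.ofRealCLM.contDiff.comp ((unitCutoff E).contDiff.comp (contDiff_const_smul R)))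

theorem dilatedCutoff_apply {R : ℝ} (hR : R ≠ 0) (ξ : E) :
    dilatedCutoff E R hR ξ = (unitCutoff E (R • ξ) : ℂ) := rfl

variable [MeasurableSpace E] [BorelSpace E]

/-- The mollifier at scale `R`: the inverse Fourier transform of `ξ ↦ χ(R ξ)`. -/
noncomputable def mollifier (E : Type*) [NormedAddCommGroup E] [InnerProductSpace ℝ E]
    [FiniteDimensional ℝ E] [MeasurableSpace E] [BorelSpace E] (R : ℝ) (hR : R ≠ 0) : 𝓢(E, ℂ) :=
  𝓕⁻ (dilatedCutoff E R hR)

/-- The homothety `x ↦ R⁻¹ x` as a continuous linear equivalence. -/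
noncomputable def invHomothety (E : Type*) [NormedAddCommGroup E] [InnerProductSpace ℝ E]
    (R : ℝ) (hR : R ≠ 0) : E ≃L[ℝ] E :=
  ContinuousLinearEquiv.smulLeft (Units.mk0 R⁻¹ (inv_ne_zero hR))

theorem mollifier_apply {R : ℝ} (hR : R ≠ 0) (x : E) :
    mollifier E R hR x = 𝓕⁻ (fun ξ : E => (unitCutoff E (R • ξ) : ℂ)) x := by
  rw [mollifier, SchwartzMap.fourierInv_coe]
  rfl

theorem mollifier_eq_smul_comp {R : ℝ} (hR : 0 < R) :
    mollifier E R hR.ne' = (R ^ finrank ℝ E)⁻¹ •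
      SchwartzMap.compCLMOfContinuousLinearEquiv ℝ (invHomothety E R hR.ne')
        (mollifier E 1 one_ne_zero) := by
  ext x
  rw [smul_apply, SchwartzMap.compCLMOfContinuousLinearEquiv_apply, Function.comp_apply,
    mollifier_apply, mollifier_apply, fourierInv_comp_smul (fun ξ : E => (unitCutoff E ξ : ℂ)) hR]
  simp_rw [one_smul]
  rfl

end

variable {d : ℕ} {s : ℝ} {u : EuclideanSpace ℝ (Fin d) → ℝ}

local notation "𝔼" => EuclideanSpace ℝ (Fin d)

/-- Removing the frequencies near the origin produces a function in the range of `(-Δ)^s` on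
Schwartz space, since `‖ξ‖ ^ (-2s)` is harmless away from the origin. -/
theorem exists_fracLaplacian_eq_sub_convolution {R : ℝ} (hR : 0 < R) (ψ : 𝓢(𝔼, ℂ)) :
    ∃ φ : 𝓢(𝔼, ℂ), ∀ x, fracLaplacian s φ x =
      ψ x - ∫ y, mollifier 𝔼 R hR.ne' (x - y) * ψ y := by
  let c : ℝ := (2 * Real.pi) ^ (-(2 * s)) * R ^ (2 * s)
  let h : 𝔼 → ℂ := fun ξ => (((1 - unitCutoff 𝔼 ξ) * ‖ξ‖ ^ (-(2 * s)) : ℝ) : ℂ)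
  let g : 𝔼 → ℂ := fun ξ => (c : ℂ) * h (R • ξ)
  have hg : g.HasTemperateGrowth := (Function.HasTemperateGrowth.const (c : ℂ)).mul
    (hasTemperateGrowth_dilate (hasTemperateGrowth_highFreqSymbol (-(2 * s))) R)
  refine ⟨SchwartzMap.fourierMultiplierCLM ℂ g ψ, fun x => ?_⟩
  let B := ContinuousLinearMap.mul ℂ ℂ
  have hsym : ∀ ξ : 𝔼, (((2 * Real.pi * ‖ξ‖) ^ (2 * s) : ℝ) : ℂ) * g ξ =
      1 - (unitCutoff 𝔼 (R • ξ) : ℂ) := by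
    intro ξ
    -- At the origin the junk value of the negative power is killed by `1 - χ(0) = 0`.
    rcases eq_or_ne ξ 0 with rfl | hξ
    · simp [g, h, unitCutoff_of_norm_le (E := 𝔼) (x := 0)]
    have hn : 0 < ‖ξ‖ := norm_pos_iff.2 hξ
    simp only [g, h, c]
    rw [norm_smul, Real.norm_of_nonneg hR.le]
    have e : (2 * Real.pi * ‖ξ‖) ^ (2 * s) * ((2 * Real.pi) ^ (-(2 * s)) * R ^ (2 * s) *
        (R * ‖ξ‖) ^ (-(2 * s))) = 1 := by
      rw [Real.mul_rpow (by positivity) hn.le, Real.mul_rpow hR.le hn.le,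
        Real.rpow_neg (by positivity), Real.rpow_neg hR.le, Real.rpow_neg hn.le]
      field_simp
    rw [← Complex.ofReal_mul, ← Complex.ofReal_mul, ← Complex.ofReal_one, ← Complex.ofReal_sub]
    congr 1
    linear_combination (1 - unitCutoff 𝔼 (R • ξ)) * e
  have hfun : (fun ξ : 𝔼 => (((2 * Real.pi * ‖ξ‖) ^ (2 * s) : ℝ) : ℂ) *
      𝓕 (SchwartzMap.fourierMultiplierCLM ℂ g ψ : 𝔼 → ℂ) ξ) =
      (𝓕 (ψ - SchwartzMap.convolution B (mollifier 𝔼 R hR.ne') ψ) : 𝓢(𝔼, ℂ)) := by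
    ext ξ
    rw [← SchwartzMap.fourier_coe, SchwartzMap.fourierMultiplierCLM_apply,
      FourierTransform.fourier_fourierInv_eq, SchwartzMap.smulLeftCLM_apply_apply hg, smul_eq_mul,
      ← mul_assoc, hsym, sub_eq_add_neg ψ, FourierTransform.fourier_add,
      FourierTransform.fourier_neg, add_apply, neg_apply,
      SchwartzMap.fourier_convolution, SchwartzMap.pairing_apply_apply, mollifier,
      FourierTransform.fourier_fourierInv_eq, dilatedCutoff_apply, ContinuousLinearMap.mul_apply']
    ring
  rw [fracLaplacian, hfun, ← SchwartzMap.fourierInv_coe, FourierTransform.fourierInv_fourier_eq,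
    sub_apply, SchwartzMap.convolution_apply, convolution_eq_swap]
  rfl

/-! ### Correlations of the solution with Schwartz functions -/

/-- The correlation `y ↦ ∫ u(x) f(x - y) dx`. -/
noncomputable def correlation {F : Type*} [NormedAddCommGroup F] [NormedSpace ℝ F]
    (u : 𝔼 → ℝ) (f : 𝓢(𝔼, F)) (y : 𝔼) : F :=
  ∫ x, u x • f (x - y)

theorem SchwartzMap.exists_one_add_norm_rpow_mul_sub_le {E F : Type*} [NormedAddCommGroup E]
    [NormedSpace ℝ E] [NormedAddCommGroup F] [NormedSpace ℝ F] (f : 𝓢(E, F)) {β : ℝ} (hβ : 0 ≤ β) :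
    ∃ A, 0 ≤ A ∧ ∀ x y, (1 + ‖x‖) ^ β * ‖f (x - y)‖ ≤ A * (1 + ‖y‖) ^ β := by
  obtain ⟨A, hA0, hA⟩ := f.exists_one_add_norm_rpow_mul_le β
  refine ⟨A, hA0, fun x y => ?_⟩
  calc (1 + ‖x‖) ^ β * ‖f (x - y)‖ ≤ ((1 + ‖y‖) ^ β * (1 + ‖x - y‖) ^ β) * ‖f (x - y)‖ := by
        gcongr; exact one_add_norm_rpow_le_mul hβ x y
    _ = (1 + ‖y‖) ^ β * ((1 + ‖x - y‖) ^ β * ‖f (x - y)‖) := by ring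
    _ ≤ (1 + ‖y‖) ^ β * A := by gcongr; exact hA _
    _ = _ := mul_comm _ _

theorem MemWeightedL1.integrable_smul_comp_sub {F : Type*} [NormedAddCommGroup F] [NormedSpace ℝ F]
    (hs : 0 ≤ s) (hu : MemWeightedL1 s u) (f : 𝓢(𝔼, F)) (y : 𝔼) :
    Integrable (fun x => u x • f (x - y)) := by
  obtain ⟨A, -, hA⟩ := f.exists_one_add_norm_rpow_mul_sub_le (β := (d : ℝ) + 2 * s) (by positivity)
  exact hu.integrable_smul
    (f.continuous.comp (continuous_id.sub continuous_const)).aestronglyMeasurable (hA · y)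

theorem hasFDerivAt_correlation (hs : 0 ≤ s) (hu : MemWeightedL1 s u) (f : 𝓢(𝔼, ℂ)) (y : 𝔼) :
    HasFDerivAt (correlation u f) (-correlation u (SchwartzMap.fderivCLM ℝ 𝔼 ℂ f) y) y := by
  set f' := SchwartzMap.fderivCLM ℝ 𝔼 ℂ f
  obtain ⟨A, hA0, hA⟩ :=
    f'.exists_one_add_norm_rpow_mul_sub_le (β := (d : ℝ) + 2 * s) (by positivity)
  have h := hasFDerivAt_integral_of_dominated_of_fderiv_le (𝕜 := ℝ) (μ := volume)
    (F := fun y x => u x • f (x - y)) (F' := fun y x => -(u x • f' (x - y))) (x₀ := y)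
    (bound := fun x => A * (2 + ‖y‖) ^ ((d : ℝ) + 2 * s) *
      (|u x| / (1 + ‖x‖) ^ ((d : ℝ) + 2 * s)))
    (Metric.ball_mem_nhds y one_pos)
    (Eventually.of_forall fun z => (hu.integrable_smul_comp_sub hs f z).aestronglyMeasurable)
    (hu.integrable_smul_comp_sub hs f y) (hu.integrable_smul_comp_sub hs f' y).neg.aestronglyMeasurable
    (Eventually.of_forall fun x z hz => ?_) (hu.2.const_mul _)
    (Eventually.of_forall fun x z _ => ?_)
  · rw [integral_neg] at h
    exact h
  · have hz' : ‖z‖ ≤ 1 + ‖y‖ := by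
      have h1 := norm_add_le (z - y) y
      rw [sub_add_cancel] at h1
      have := mem_ball_iff_norm.1 hz
      linarith
    rw [norm_neg, norm_smul, Real.norm_eq_abs, mul_div_assoc', le_div_iff₀ (by positivity)]
    calc |u x| * ‖f' (x - z)‖ * (1 + ‖x‖) ^ ((d : ℝ) + 2 * s)
        = |u x| * ((1 + ‖x‖) ^ ((d : ℝ) + 2 * s) * ‖f' (x - z)‖) := by ring
      _ ≤ |u x| * (A * (2 + ‖y‖) ^ ((d : ℝ) + 2 * s)) := by
          refine mul_le_mul_of_nonneg_left ((hA x z).trans ?_) (abs_nonneg _)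
          exact mul_le_mul_of_nonneg_left
            (Real.rpow_le_rpow (by positivity) (by linarith) (by positivity)) hA0
      _ = _ := mul_comm _ _
  · have h1 : HasFDerivAt (fun z => f (x - z)) (-(f' (x - z))) z := by
      have := (f.hasFDerivAt (x - z)).comp z ((hasFDerivAt_id z).const_sub x)
      convert! this using 1
      ext v
      simp [f']
    rw [← smul_neg]
    exact h1.const_smul (u x)

theorem continuous_correlation (hs : 0 ≤ s) (hu : MemWeightedL1 s u) (f : 𝓢(𝔼, ℂ)) :
    Continuous (correlation u f) :=
  continuous_iff_continuousAt.2 fun y => (hasFDerivAt_correlation hs hu f y).continuousAt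

/-- Fubini's theorem moves a convolution from the test function onto `u`. -/
theorem integral_smul_convolution_eq (hs : 0 ≤ s) (hu : MemWeightedL1 s u) (f ψ : 𝓢(𝔼, ℂ)) :
    ∫ x, u x • ∫ y, f (x - y) * ψ y = ∫ y, ψ y * correlation u f y := by
  obtain ⟨A, hA0, hA⟩ :=
    f.exists_one_add_norm_rpow_mul_sub_le (β := (d : ℝ) + 2 * s) (by positivity)
  have hψ : Integrable (fun y => (1 + ‖y‖) ^ ((d : ℝ) + 2 * s) * ‖ψ y‖) := by
    obtain ⟨C, hC0, hC⟩ := ψ.exists_one_add_norm_rpow_mul_le ((d : ℝ) + 2 * s + (d + 1))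
    refine ((integrable_one_add_norm (E := 𝔼) (μ := volume) (r := (d : ℝ) + 1) (by simp)).const_mul
      C).mono' ?_ (Eventually.of_forall fun y => ?_)
    · refine Continuous.aestronglyMeasurable (Continuous.mul ?_ ψ.continuous.norm)
      exact (continuous_const.add continuous_norm).rpow_const fun y => Or.inr (by positivity)
    · rw [Real.norm_of_nonneg (by positivity), Real.rpow_neg (by positivity), ← div_eq_mul_inv,
        le_div_iff₀ (by positivity)]
      have := hC y
      rw [Real.rpow_add (by positivity)] at this
      linarith
  have hint : Integrable (Function.uncurry fun x y => u x • (f (x - y) * ψ y))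
      ((volume : Measure 𝔼).prod volume) := by
    refine ((hu.2.mul_prod hψ).const_mul A).mono' ?_ (Eventually.of_forall fun z => ?_)
    · refine (hu.1.aestronglyMeasurable.comp_fst).smul (Continuous.aestronglyMeasurable ?_)
      exact (f.continuous.comp (continuous_fst.sub continuous_snd)).mul
        (ψ.continuous.comp continuous_snd)
    · simp only [Function.uncurry]
      rw [norm_smul, norm_mul, Real.norm_eq_abs]
      have h1 := hA z.1 z.2
      have h2 : 0 < (1 + ‖z.1‖) ^ ((d : ℝ) + 2 * s) := by positivity
      rw [mul_comm, ← le_div_iff₀ h2] at h1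
      calc |u z.1| * (‖f (z.1 - z.2)‖ * ‖ψ z.2‖)
          ≤ |u z.1| * (A * (1 + ‖z.2‖) ^ ((d : ℝ) + 2 * s) /
            (1 + ‖z.1‖) ^ ((d : ℝ) + 2 * s) * ‖ψ z.2‖) := by gcongr
        _ = _ := by ring
  simp_rw [← integral_smul]
  rw [integral_integral_swap hint]
  simp_rw [correlation, ← integral_const_mul]
  congr 1; ext y; congr 1; ext x
  simp only [Complex.real_smul]
  ring

/-- A solution reproduces itself under every mollifier whose Fourier transform is one near the
origin: in effect its Fourier transform is supported at the origin. -/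
theorem ae_eq_correlation_mollifier (hs : 0 ≤ s) (hu : MemWeightedL1 s u)
    (hsol : FracLaplacianEq s ⊤ u 0) {R : ℝ} (hR : 0 < R) :
    ∀ᵐ x, (u x : ℂ) = correlation u (mollifier 𝔼 R hR.ne') x := by
  set η := mollifier 𝔼 R hR.ne' with hη
  refine ae_eq_of_integral_contDiff_smul_eq
    (hu.1.mono (Complex.continuous_ofReal.comp_aestronglyMeasurable hu.1.aestronglyMeasurable)
      (by simp)) (continuous_correlation hs hu η).locallyIntegrable fun g hg hc => ?_
  let ψ : 𝓢(𝔼, ℂ) := (hc.comp_left Complex.ofReal_zero).toSchwartzMap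
    (Complex.ofRealCLM.contDiff.comp hg)
  have hψ : ∀ x, ψ x = (g x : ℂ) := fun x => rfl
  obtain ⟨φ, hφ⟩ := exists_fracLaplacian_eq_sub_convolution (s := s) hR ψ
  have h0 := FracLaplacianEq.integral_smul_eq_zero hs hu hsol φ
  have i₁ : Integrable (fun x => u x • ψ x) := by
    simpa using hu.integrable_smul_comp_sub hs ψ 0
  have i₂ : Integrable (fun x => u x • ∫ y, η (x - y) * ψ y) := by
    refine (i₁.sub (hu.integrable_smul_fracLaplacian hs φ)).congr (Eventually.of_forall fun x => ?_)
    simp only [Pi.sub_apply, hφ x, smul_sub, sub_sub_cancel, hη]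
  simp_rw [hφ, smul_sub] at h0
  rw [integral_sub i₁ i₂, integral_smul_convolution_eq hs hu, sub_eq_zero] at h0
  calc ∫ x, g x • (u x : ℂ) = ∫ x, u x • ψ x := by
        congr 1; ext x
        rw [hψ, Complex.real_smul, Complex.real_smul, mul_comm]
    _ = _ := h0
    _ = _ := by
        congr 1

end

/-! ### Derivatives of correlations and polynomials -/

section

/-- A finite chain of derivatives ending in zero is a Taylor polynomial. -/
theorem eq_taylor_sum_of_hasDerivAt_chain {F : Type*} [NormedAddCommGroup F] [NormedSpace ℝ F]
    (n : ℕ) {g : ℕ → ℝ → F} (hg : ∀ k t, HasDerivAt (g k) (g (k + 1) t) t)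
    (hn : ∀ t, g n t = 0) (t : ℝ) :
    g 0 t = ∑ k ∈ Finset.range n, (t ^ k / (k.factorial : ℝ)) • g k 0 := by
  induction n generalizing g t with
  | zero => simpa using hn t
  | succ n ih =>
    have h1 := ih (g := fun k => g (k + 1)) (fun k t => hg (k + 1) t) hn
    let r : ℝ → F := fun t => g 0 t - ∑ k ∈ Finset.range (n + 1), (t ^ k / (k.factorial : ℝ)) • g k 0
    have hr : ∀ t, HasDerivAt r 0 t := by
      intro t
      have h2 : HasDerivAt (fun t : ℝ => ∑ k ∈ Finset.range (n + 1),
          (t ^ k / (k.factorial : ℝ)) • g k 0)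
          (∑ k ∈ Finset.range n, (t ^ k / (k.factorial : ℝ)) • g (k + 1) 0) t := by
        simp_rw [Finset.sum_range_succ' _ n]
        have h3 : HasDerivAt (fun t : ℝ => ∑ k ∈ Finset.range n,
            (t ^ (k + 1) / ((k + 1).factorial : ℝ)) • g (k + 1) 0)
            (∑ k ∈ Finset.range n, (t ^ k / (k.factorial : ℝ)) • g (k + 1) 0) t := by
          refine HasDerivAt.fun_sum fun k _ => ?_
          refine HasDerivAt.smul_const ?_ _
          convert! (hasDerivAt_pow (k + 1) t).div_const ((k + 1).factorial : ℝ) using 1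
          rw [Nat.factorial_succ]
          push_cast
          have : (k.factorial : ℝ) ≠ 0 := by positivity
          field_simp
        simpa using h3.add_const ((1 : ℝ) • g 0 0)
      have := (hg 0 t).sub h2
      rwa [h1 t, sub_self] at this
    have h4 : r t = r 0 := is_const_of_deriv_eq_zero (fun t => (hr t).differentiableAt)
      (fun t => (hr t).deriv) t 0
    have h5 : r 0 = 0 := by
      simp [r, Finset.sum_range_succ']
    exact sub_eq_zero.1 (h4.trans h5)

variable {d : ℕ} {s : ℝ} {u : EuclideanSpace ℝ (Fin d) → ℝ}

local notation "𝔼" => EuclideanSpace ℝ (Fin d)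

/-- The correlation at a point, as a linear functional on Schwartz space. -/
noncomputable def correlationₗ (hs : 0 ≤ s) (hu : MemWeightedL1 s u) (y : 𝔼) : 𝓢(𝔼, ℂ) →ₗ[ℝ] ℂ where
  toFun f := correlation u f y
  map_add' f g := by
    simp only [correlation, add_apply, smul_add]
    exact integral_add (hu.integrable_smul_comp_sub hs f y) (hu.integrable_smul_comp_sub hs g y)
  map_smul' c f := by
    simp only [correlation, smul_apply, RingHom.id_apply, ← integral_smul]
    congr 1; ext x
    rw [smul_comm]

theorem correlation_fderivCLM_apply (hs : 0 ≤ s) (hu : MemWeightedL1 s u) (f : 𝓢(𝔼, ℂ))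
    (y z : 𝔼) :
    correlation u (SchwartzMap.fderivCLM ℝ 𝔼 ℂ f) y z = correlation u (∂_{z} f) y := by
  rw [correlation, ContinuousLinearMap.integral_apply (hu.integrable_smul_comp_sub hs _ y)]
  rfl

theorem correlation_lineDeriv_congr (hs : 0 ≤ s) (hu : MemWeightedL1 s u) {f g : 𝓢(𝔼, ℂ)}
    (h : correlation u f = correlation u g) (z : 𝔼) :
    correlation u (∂_{z} f) = correlation u (∂_{z} g) := by
  ext y
  have h1 := hasFDerivAt_correlation hs hu f y
  rw [h] at h1
  have h2 := h1.unique (hasFDerivAt_correlation hs hu g y)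
  rw [← correlation_fderivCLM_apply hs hu, ← correlation_fderivCLM_apply hs hu, neg_inj.1 h2]

theorem correlation_lineDeriv_pow_congr (hs : 0 ≤ s) (hu : MemWeightedL1 s u) {f g : 𝓢(𝔼, ℂ)}
    (h : correlation u f = correlation u g) (z : 𝔼) (k : ℕ) :
    correlation u ((lineDerivOpCLM ℝ 𝓢(𝔼, ℂ) z ^ k) f) =
      correlation u ((lineDerivOpCLM ℝ 𝓢(𝔼, ℂ) z ^ k) g) := by
  induction k with
  | zero => exact h
  | succ k ih =>
    rw [pow_succ']
    exact correlation_lineDeriv_congr hs hu ih z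

theorem lineDeriv_pow_mollifier {R : ℝ} (hR : 0 < R) (z : 𝔼) (k : ℕ) :
    (lineDerivOpCLM ℝ 𝓢(𝔼, ℂ) z ^ k) (mollifier 𝔼 R hR.ne') =
      (R⁻¹ ^ k * (R ^ d)⁻¹) •
        SchwartzMap.compCLMOfContinuousLinearEquiv ℝ (invHomothety 𝔼 R hR.ne')
          ((lineDerivOpCLM ℝ 𝓢(𝔼, ℂ) z ^ k) (mollifier 𝔼 1 one_ne_zero)) := by
  induction k with
  | zero => simpa using mollifier_eq_smul_comp (E := 𝔼) hR
  | succ k ih =>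
    rw [pow_succ', mul_apply_eq_comp, ih, map_smul, lineDerivOpCLM_apply,
      SchwartzMap.lineDerivOp_compCLMOfContinuousLinearEquiv, mul_apply_eq_comp,
      lineDerivOpCLM_apply]
    have : invHomothety 𝔼 R hR.ne' z = R⁻¹ • z := rfl
    rw [this, lineDerivOp_left_smul, map_smul, smul_smul]
    congr 1
    ring

/-- Directional derivatives of order at least `2s` of the solution vanish: each is a correlation
with a derivative of the mollifier at every scale `R`, and letting `R → ∞` makes it vanish. -/
theorem correlation_lineDeriv_pow_mollifier_eq_zero (hs : 0 < s) (hu : MemWeightedL1 s u)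
    (hsol : FracLaplacianEq s ⊤ u 0) {k : ℕ} (hk : 2 * s ≤ k) (z y : 𝔼) :
    correlation u ((lineDerivOpCLM ℝ 𝓢(𝔼, ℂ) z ^ k) (mollifier 𝔼 1 one_ne_zero)) y = 0 := by
  set β := (d : ℝ) + 2 * s with hβ
  have hβ0 : 0 < β := by positivity
  set g := (lineDerivOpCLM ℝ 𝓢(𝔼, ℂ) z ^ k) (mollifier 𝔼 1 one_ne_zero) with hg
  obtain ⟨A, hA0, hA⟩ := g.exists_one_add_norm_rpow_mul_le β
  let G : ℝ → 𝔼 → ℂ := fun R x => (R⁻¹ ^ k * (R ^ d)⁻¹) • g (R⁻¹ • (x - y))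
  -- The correlations with all mollifiers agree almost everywhere, hence everywhere by continuity.
  have hG : ∀ R : ℝ, 0 < R → ∫ x, u x • G R x = correlation u g y := by
    intro R hR
    have h1 : correlation u (mollifier 𝔼 1 one_ne_zero) = correlation u (mollifier 𝔼 R hR.ne') := by
      rw [← (continuous_correlation hs.le hu _).ae_eq_iff_eq volume
        (continuous_correlation hs.le hu _)]
      filter_upwards [ae_eq_correlation_mollifier hs.le hu hsol one_pos,
        ae_eq_correlation_mollifier hs.le hu hsol hR] with x h1 h2
      rw [← h1, ← h2]
    rw [hg, correlation_lineDeriv_pow_congr hs.le hu h1, lineDeriv_pow_mollifier hR]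
    rfl
  have hbound : ∀ R : ℝ, 1 ≤ R → ∀ x, (R + ‖x - y‖) ^ β * ‖G R x‖ ≤ A := by
    intro R hR x
    have hR0 : 0 < R := by linarith
    have h1 := hA (R⁻¹ • (x - y))
    have h2 : R + ‖x - y‖ = R * (1 + ‖R⁻¹ • (x - y)‖) := by
      rw [norm_smul, norm_inv, Real.norm_of_nonneg hR0.le]
      field_simp
    have h3 : R ^ β * (R⁻¹ ^ k * (R ^ d)⁻¹) ≤ 1 := by
      rw [← Real.rpow_natCast R⁻¹, ← Real.rpow_natCast R d, Real.inv_rpow hR0.le,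
        ← Real.rpow_neg hR0.le, ← Real.rpow_neg hR0.le, ← Real.rpow_add hR0, ← Real.rpow_add hR0]
      exact Real.rpow_le_one_of_one_le_of_nonpos hR (by rw [hβ]; linarith)
    simp only [G]
    rw [h2, Real.mul_rpow hR0.le (by positivity), norm_smul (R⁻¹ ^ k * (R ^ d)⁻¹),
      Real.norm_of_nonneg (by positivity)]
    calc _ = (R ^ β * (R⁻¹ ^ k * (R ^ d)⁻¹)) *
          ((1 + ‖R⁻¹ • (x - y)‖) ^ β * ‖g (R⁻¹ • (x - y))‖) := by ring
      _ ≤ 1 * A := by gcongr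
      _ = A := one_mul A
  have hlim : Tendsto (fun R : ℝ => ∫ x, u x • G R x) atTop (𝓝 (∫ _x : 𝔼, (0 : ℂ))) := by
    refine tendsto_integral_filter_of_dominated_convergence
      (fun x => A * (1 + ‖y‖) ^ β * (|u x| / (1 + ‖x‖) ^ β)) ?_ ?_ (hu.2.const_mul _) ?_
    · refine Eventually.of_forall fun R => hu.1.aestronglyMeasurable.smul ?_
      have : Continuous fun x : 𝔼 => R⁻¹ • (x - y) :=
        (continuous_id.sub continuous_const).const_smul R⁻¹
      exact ((g.continuous.comp this).const_smul (R⁻¹ ^ k * (R ^ d)⁻¹)).aestronglyMeasurable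
    · filter_upwards [eventually_ge_atTop 1] with R hR
      refine Eventually.of_forall fun x => ?_
      rw [norm_smul, Real.norm_eq_abs, mul_div_assoc', le_div_iff₀ (by positivity)]
      have h1 : (1 + ‖x‖) ^ β * ‖G R x‖ ≤ (1 + ‖y‖) ^ β * A := by
        calc (1 + ‖x‖) ^ β * ‖G R x‖ ≤ ((1 + ‖y‖) ^ β * (1 + ‖x - y‖) ^ β) * ‖G R x‖ := by
              gcongr; exact one_add_norm_rpow_le_mul hβ0.le x y
          _ ≤ ((1 + ‖y‖) ^ β * (R + ‖x - y‖) ^ β) * ‖G R x‖ := by gcongr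
          _ = (1 + ‖y‖) ^ β * ((R + ‖x - y‖) ^ β * ‖G R x‖) := by ring
          _ ≤ _ := by gcongr; exact hbound R hR x
      nlinarith [abs_nonneg (u x)]
    · refine Eventually.of_forall fun x => ?_
      rw [← smul_zero (u x)]
      refine Tendsto.const_smul ?_ _
      refine squeeze_zero_norm' (a := fun R : ℝ => A * R ^ (-β)) ?_ ?_
      · filter_upwards [eventually_ge_atTop 1] with R hR
        have hR0 : 0 < R := by linarith
        rw [Real.rpow_neg hR0.le, ← div_eq_mul_inv, le_div_iff₀ (by positivity), mul_comm]
        refine le_trans ?_ (hbound R hR x)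
        gcongr
        simp
      · simpa using (tendsto_rpow_neg_atTop hβ0).const_mul A
  rw [integral_zero] at hlim
  refine tendsto_nhds_unique (tendsto_const_nhds.congr' ?_) hlim
  filter_upwards [eventually_gt_atTop 0] with R hR using (hG R hR).symm

/-- A linear functional of the `k`-th derivative in direction `z` is a polynomial in `z`, because
`∂_z = ∑ i, z i ∂_i`. -/
theorem exists_mvPolynomial_eval_eq_lineDeriv_pow (L : 𝓢(𝔼, ℂ) →ₗ[ℝ] ℝ) (k : ℕ)
    (f : 𝓢(𝔼, ℂ)) :
    ∃ P : MvPolynomial (Fin d) ℝ, P.totalDegree ≤ k ∧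
      ∀ z : 𝔼, MvPolynomial.eval (fun i => z i) P = L ((lineDerivOpCLM ℝ 𝓢(𝔼, ℂ) z ^ k) f) := by
  induction k generalizing f with
  | zero => exact ⟨MvPolynomial.C (L f), by simp, fun z => by simp⟩
  | succ k ih =>
    choose P hP hPe using fun i : Fin d => ih (∂_{EuclideanSpace.single i (1 : ℝ)} f)
    refine ⟨∑ i, MvPolynomial.X i * P i, ?_, fun z => ?_⟩
    · refine MvPolynomial.totalDegree_finsetSum_le fun i _ => ?_
      refine (MvPolynomial.totalDegree_mul _ _).trans ?_
      rw [MvPolynomial.totalDegree_X, add_comm]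
      exact Nat.add_le_add_right (hP i) 1
    · have hz : ∂_{z} f = ∑ i, z i • ∂_{EuclideanSpace.single i (1 : ℝ)} f := by
        have : z = ∑ i, z i • EuclideanSpace.single i (1 : ℝ) := by
          ext j; simp [Pi.single_apply]
        conv_lhs => rw [this]
        rw [lineDerivOp_left_sum]
        simp_rw [lineDerivOp_left_smul]
      rw [pow_succ, mul_apply_eq_comp, lineDerivOpCLM_apply, hz]
      simp only [map_sum, map_mul, MvPolynomial.eval_X, hPe, map_smul, smul_eq_mul]

/-- Taylor expansion along rays: a correlation all of whose directional derivatives of order `n`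
vanish is a polynomial of degree less than `n`. -/
theorem exists_mvPolynomial_eval_eq_re_correlation (hs : 0 ≤ s) (hu : MemWeightedL1 s u)
    (f : 𝓢(𝔼, ℂ)) (n : ℕ)
    (h : ∀ z y : 𝔼, correlation u ((lineDerivOpCLM ℝ 𝓢(𝔼, ℂ) z ^ n) f) y = 0) :
    ∃ P : MvPolynomial (Fin d) ℝ, P.totalDegree ≤ n - 1 ∧
      ∀ z : 𝔼, MvPolynomial.eval (fun i => z i) P = (correlation u f z).re := by
  choose P hP hPe using fun k : ℕ => exists_mvPolynomial_eval_eq_lineDeriv_pow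
    (Complex.reLm ∘ₗ correlationₗ hs hu 0) k f
  refine ⟨∑ k ∈ Finset.range n, MvPolynomial.C ((-1) ^ k / (k.factorial : ℝ)) * P k, ?_,
    fun z => ?_⟩
  · refine MvPolynomial.totalDegree_finsetSum_le fun k hk => ?_
    refine (MvPolynomial.totalDegree_mul _ _).trans ?_
    rw [MvPolynomial.totalDegree_C, zero_add]
    exact (hP k).trans (Nat.le_sub_one_of_lt (Finset.mem_range.1 hk))
  -- Each derivative of `y ↦ f(x - y)` brings a sign, whence the factor `(-1) ^ k`.
  · have ht := eq_taylor_sum_of_hasDerivAt_chain n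
      (g := fun k t => (-1 : ℝ) ^ k • correlation u ((lineDerivOpCLM ℝ 𝓢(𝔼, ℂ) z ^ k) f) (t • z))
      (fun k t => ?_) (fun t => by rw [h, smul_zero]) 1
    · simp only [pow_zero, one_smul, zero_smul, one_pow, one_apply_eq_self] at ht
      rw [ht, Complex.re_sum, map_sum]
      refine Finset.sum_congr rfl fun k _ => ?_
      rw [map_mul, MvPolynomial.eval_C, hPe, smul_smul, Complex.smul_re, smul_eq_mul]
      have : (Complex.reLm ∘ₗ correlationₗ hs hu 0) ((lineDerivOpCLM ℝ 𝓢(𝔼, ℂ) z ^ k) f) =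
        (correlation u ((lineDerivOpCLM ℝ 𝓢(𝔼, ℂ) z ^ k) f) 0).re := rfl
      rw [this]
      ring
    · have h1 := (hasFDerivAt_correlation hs hu ((lineDerivOpCLM ℝ 𝓢(𝔼, ℂ) z ^ k) f)
        (t • z)).comp_hasDerivAt t ((hasDerivAt_id t).smul_const z)
      have h2 := h1.const_smul ((-1 : ℝ) ^ k)
      convert! h2 using 1
      rw [one_smul, neg_apply, correlation_fderivCLM_apply hs hu, pow_succ, pow_succ',
        mul_apply_eq_comp, lineDerivOpCLM_apply, mul_neg_one, neg_smul, smul_neg]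

end

theorem theorem1p1 (d : ℕ) (s : ℝ) (hs : 0 < s) (hsd : s < (d : ℝ) / 2)
    (u : EuclideanSpace ℝ (Fin d) → ℝ) (hu : MemWeightedL1 s u)
    (hsol : FracLaplacianEq s ⊤ u 0) :
    ∃ P : MvPolynomial (Fin d) ℝ, (P.totalDegree : ℝ) < 2 * s ∧
      ∀ᵐ x : EuclideanSpace ℝ (Fin d) ∂volume,
        u x = MvPolynomial.eval (fun i => x i) P := by
  -- The largest degree that survives is `⌈2s⌉ - 1`, which is strictly less than `2s`.
  have hn : 0 < ⌈2 * s⌉₊ := Nat.ceil_pos.2 (by linarith)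
  obtain ⟨P, hP, hPe⟩ := exists_mvPolynomial_eval_eq_re_correlation hs.le hu
    (mollifier _ 1 one_ne_zero) ⌈2 * s⌉₊ fun z y =>
      correlation_lineDeriv_pow_mollifier_eq_zero hs hu hsol (Nat.le_ceil _) z y
  refine ⟨P, ?_, ?_⟩
  · exact Nat.lt_ceil.1 (lt_of_le_of_lt hP (Nat.sub_lt hn one_pos))
  · filter_upwards [ae_eq_correlation_mollifier hs.le hu hsol one_pos] with x hx
    rw [hPe, ← hx, Complex.ofReal_re]
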